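/- Let $p$ be a prime, let $G$ be a compact $p$-adic analytic group (a compact topological group that carries a finite-dimensional analytic manifold structure over $\mathbb{Q}_p$, compatible with its topology, for which multiplication and inversion are analytic), and let $k$ be a commutative ring of characteristic $m>0$. Let $V$ be a smooth representation of $G$ on a $k$-module, i.e. a $k$-linear representation for which the action map $G\times V\to V$ is continuous when $V$ carries the discrete topology. Then every $1$-cocycle $\chi\colon G\to V$ (a map with $\chi(gh)=\chi(g)+g\chi(h)$ for all $g,h\in G$, with no continuity assumed) is continuous for the discrete topology on $V$. Moreover, let $H^1_{\mathrm{abs}}(G,V)$ be the first cohomology group of $G$ as an abstract group, computed by the complex of all inhomogeneous cochains $G^n\to V$, and let $H^1_{\mathrm{cont}}(G,V)$ be the first cohomology group of the subcomplex of continuous inhomogeneous cochains, where $V$ is discrete. Then the comparison map $\varphi^1\colon H^1_{\mathrm{cont}}(G,V)\to H^1_{\mathrm{abs}}(G,V)$ induced by the inclusion of complexes is an isomorphism of $k$-modules. -/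

import Mathlib

open scoped Manifold ContDiff

universe u

/-- A topological group `G` is `p`-adic analytic if it carries the structure of a (finite
dimensional) analytic manifold over `ℚ_[p]`, compatible with its topology, for which multiplication
and inversion are analytic. -/
def IsPAdicAnalyticGroup (p : ℕ) [Fact p.Prime] (G : Type u) [Group G] [TopologicalSpace G] :
    Prop :=
  ∃ (d : ℕ) (_ : ChartedSpace (Fin d → ℚ_[p]) G), LieGroup 𝓘(ℚ_[p], Fin d → ℚ_[p]) ω G

namespace SmoothRep

open CategoryTheory

section Basic

variable {k G : Type u} [CommRing k] [Group G] [TopologicalSpace G]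

/-- A representation `V` of a topological group `G` is smooth if the action map `G × V → V` is
continuous, where `V` carries the discrete topology. -/
def IsSmooth (V : Rep.{u} k G) : Prop :=
  letI : TopologicalSpace V := ⊥
  Continuous fun x : G × V => V.ρ x.1 x.2

/-- Continuity of a map from a topological space to `V`, where `V` carries the discrete topology. -/
def IsCont {X : Type u} [TopologicalSpace X] (V : Rep.{u} k G) (f : X → V) : Prop :=
  letI : TopologicalSpace V := ⊥
  Continuous f

/-- The `k`-module of continuous maps `G ^ n → V`, where `V` carries the discrete topology. -/
def contCochain (V : Rep.{u} k G) (n : ℕ) : Submodule k ((Fin n → G) → V) where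
  carrier := {f | IsCont V f}
  zero_mem' := by
    let _ : TopologicalSpace V := ⊥
    exact continuous_const (y := (0 : V))
  add_mem' {f g} hf hg := by
    let _ : TopologicalSpace V := ⊥
    have : DiscreteTopology V := ⟨rfl⟩
    exact Continuous.add (f := f) (g := g) hf hg
  smul_mem' c f hf := by
    let _ : TopologicalSpace V := ⊥
    have : DiscreteTopology V := ⟨rfl⟩
    exact (continuous_of_discreteTopology (f := fun v : V => c • v)).comp
      (show Continuous f from hf)

theorem continuous_contractNth [IsTopologicalGroup G] {n : ℕ} (j : Fin (n + 1)) :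
    Continuous fun g : Fin (n + 1) → G => Fin.contractNth j (· * ·) g := by
  refine continuous_pi fun i => ?_
  unfold Fin.contractNth
  split_ifs <;> fun_prop

/-- For smooth `V`, the differential of the inhomogeneous cochain complex preserves continuity. -/
theorem d_mem_contCochain [IsTopologicalGroup G] {V : Rep.{u} k G} (hV : IsSmooth V) (n : ℕ)
    {f : (Fin n → G) → V} (hf : f ∈ contCochain V n) :
    (inhomogeneousCochains.d V n).hom f ∈ contCochain V (n + 1) := by
  let _ : TopologicalSpace V := ⊥
  have : DiscreteTopology V := ⟨rfl⟩
  have hf' : Continuous f := hf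
  have hV' : Continuous fun x : G × V => V.ρ x.1 x.2 := hV
  show Continuous fun g : Fin (n + 1) → G => (inhomogeneousCochains.d V n).hom f g
  simp only [inhomogeneousCochains.d_hom_apply]
  refine Continuous.add ?_ (continuous_finsetSum _ fun j _ => ?_)
  · exact hV'.comp (f := fun g : Fin (n + 1) → G => (g 0, f fun i => g i.succ)) (by fun_prop)
  · exact (continuous_of_discreteTopology (f := fun v : V => (-1 : k) ^ ((j : ℕ) + 1) • v)).comp
      (hf'.comp (continuous_contractNth j))

end Basic

noncomputable section Complex

variable {k G : Type u} [CommRing k] [Group G] [TopologicalSpace G] [IsTopologicalGroup G]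
  {V : Rep.{u} k G} (hV : IsSmooth V)

/-- The differential on continuous inhomogeneous cochains: the restriction of the usual one. -/
def contD (n : ℕ) :
    ModuleCat.of k (contCochain V n) ⟶ ModuleCat.of k (contCochain V (n + 1)) :=
  ModuleCat.ofHom
    ((inhomogeneousCochains.d V n).hom.restrict fun _ hf => d_mem_contCochain hV n hf)

theorem contD_comp_contD (n : ℕ) : contD hV n ≫ contD hV (n + 1) = 0 := by
  refine ModuleCat.hom_ext (LinearMap.ext fun f => Subtype.ext ?_)
  exact LinearMap.congr_fun
    (congrArg ModuleCat.Hom.hom (groupCohomology.inhomogeneousCochains.d_comp_d n V)) f.1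

/-- The complex `0 → C(G ^ 0, V) → C(G ^ 1, V) → C(G ^ 2, V) → ⋯` of continuous inhomogeneous
cochains with values in the smooth representation `V`, which carries the discrete topology. -/
def contCochains : CochainComplex (ModuleCat k) ℕ :=
  CochainComplex.of (fun n => ModuleCat.of k (contCochain V n)) (contD hV) (contD_comp_contD hV)

/-- The `q`-th continuous cohomology `H^q_cont(G, V)` of a smooth representation `V`. -/
def contCohomology (q : ℕ) : ModuleCat k := (contCochains hV).homology q

/-- The inclusion of the complex of continuous cochains into the complex of all cochains. -/
def contCochainsInclusion : contCochains hV ⟶ groupCohomology.inhomogeneousCochains V :=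
  CochainComplex.ofHom (fun n => ModuleCat.ofHom (contCochain V n).subtype) (fun n => by
    simp only [contCochains, CochainComplex.of_d]
    rfl)

/-- The comparison map `H^q_cont(G, V) → H^q_abs(G, V)`, where the target is the cohomology of `G`
as an abstract group. -/
def comparison (q : ℕ) : contCohomology hV q ⟶ groupCohomology V q :=
  HomologicalComplex.homologyMap (contCochainsInclusion hV) q

end Complex

end SmoothRep

section Cocycle

open groupCohomology SmoothRep

variable {k G : Type u} [CommRing k] [Group G] {V : Rep.{u} k G}

/-- The zero set of a cocycle. -/
def cocycleKernel (χ : cocycles₁ V) : Subgroup G where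
  carrier := {g | χ g = 0}
  mul_mem' {a b} (ha : χ a = 0) (hb : χ b = 0) := by
    show χ (a * b) = 0
    rw [(mem_cocycles₁_iff χ).1 χ.2, ha, hb, map_zero, add_zero]
  one_mem' := cocycles₁_map_one χ
  inv_mem' {a} (ha : χ a = 0) := by
    show χ a⁻¹ = 0
    have h := cocycles₁_map_inv χ a
    rw [ha, neg_zero] at h
    rw [← V.ρ.inv_self_apply a (χ a⁻¹), h, map_zero]

theorem mem_cocycleKernel {χ : cocycles₁ V} {g : G} : g ∈ cocycleKernel χ ↔ χ g = 0 := Iff.rfl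

theorem cocycle_map_pow_of_fixed (χ : cocycles₁ V) {g : G} (h : V.ρ g (χ g) = χ g) (n : ℕ) :
    χ (g ^ n) = n • χ g := by
  induction n with
  | zero => simp
  | succ n ih =>
    rw [pow_succ', (mem_cocycles₁_iff χ).1 χ.2, ih, map_nsmul, h, succ_nsmul]

/-- If `a` lies in the kernel and commutes with `b`, then `a` fixes the value at `b`. -/
theorem cocycle_fixed_of_commute (χ : cocycles₁ V) {a b : G} (ha : χ a = 0) (hab : Commute a b) :
    V.ρ a (χ b) = χ b := by
  have h₁ := (mem_cocycles₁_iff χ).1 χ.2 a b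
  have h₂ := (mem_cocycles₁_iff χ).1 χ.2 b a
  rw [ha, add_zero] at h₁
  rw [ha, map_zero, zero_add] at h₂
  rw [← h₁, hab.eq, h₂]

variable [TopologicalSpace G]

theorem SmoothRep.IsSmooth.isClopen_fixing (hV : IsSmooth V) (v w : V) :
    IsClopen {g : G | V.ρ g v = w} := by
  let _ : TopologicalSpace V := ⊥
  have : DiscreteTopology V := ⟨rfl⟩
  have hV' : Continuous fun x : G × V => V.ρ x.1 x.2 := hV
  have h : Continuous fun g : G => V.ρ g v := hV'.comp (by fun_prop : Continuous fun g : G => (g, v))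
  exact (isClopen_discrete ({w} : Set V)).preimage h

/-- In a compact group, some positive power of any element fixes a given vector of a smooth
representation. -/
theorem SmoothRep.IsSmooth.exists_pow_fixing [IsTopologicalGroup G] [CompactSpace G]
    (hV : IsSmooth V) (g : G) (v : V) : ∃ n : ℕ, 0 < n ∧ V.ρ (g ^ n) v = v := by
  let H : Subgroup G :=
    { carrier := {g : G | V.ρ g v = v}
      mul_mem' := fun {a b} (ha : V.ρ a v = v) (hb : V.ρ b v = v) => by
        simp [ha, hb]
      one_mem' := by simp
      inv_mem' := fun {a} (ha : V.ρ a v = v) => by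
        show V.ρ a⁻¹ v = v
        nth_rw 1 [← ha]
        simp }
  have hH : IsOpen (H : Set G) := (hV.isClopen_fixing v v).isOpen
  have : Finite (G ⧸ H) := H.quotient_finite_of_isOpen hH
  have : H.FiniteIndex := H.finiteIndex_of_finite_quotient
  obtain ⟨n, hn, -, h⟩ := H.exists_pow_mem_of_index_ne_zero H.index_ne_zero_of_finite g
  exact ⟨n, hn, h⟩

theorem exists_pow_mem_cocycleKernel [IsTopologicalGroup G] [CompactSpace G] (hV : IsSmooth V)
    {m : ℕ} (hm : 0 < m) (hmV : ∀ v : V, m • v = 0) (χ : cocycles₁ V) (x : G) :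
    ∃ N : ℕ, 0 < N ∧ x ^ N ∈ cocycleKernel χ := by
  obtain ⟨n, hn, hfix⟩ := hV.exists_pow_fixing x (χ x)
  have hfix' : ∀ j : ℕ, V.ρ (x ^ n) (χ (x ^ j)) = χ (x ^ j) := fun j => by
    induction j with
    | zero => simp
    | succ j ih =>
      have hc : V.ρ (x ^ n) (V.ρ x (χ (x ^ j))) = V.ρ x (V.ρ (x ^ n) (χ (x ^ j))) := by
        rw [← Module.End.mul_apply, ← map_mul, ← pow_succ, pow_succ', map_mul,
          Module.End.mul_apply]
      rw [pow_succ', (mem_cocycles₁_iff χ).1 χ.2, map_add, hc, ih, hfix]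
  refine ⟨n * m, Nat.mul_pos hn hm, ?_⟩
  rw [mem_cocycleKernel, pow_mul, cocycle_map_pow_of_fixed χ (hfix' n), hmV]

/-- A cocycle with values in a smooth representation of finite exponent vanishes on a procyclic
subgroup generated by a positive power of any given element. -/
theorem exists_closure_zpowers_le_cocycleKernel [IsTopologicalGroup G] [CompactSpace G] [T2Space G]
    (hV : IsSmooth V) {m : ℕ} (hm : 0 < m) (hmV : ∀ v : V, m • v = 0) (χ : cocycles₁ V) (x : G) :
    ∃ M : ℕ, 0 < M ∧
      (Subgroup.zpowers (x ^ M)).topologicalClosure ≤ cocycleKernel χ := by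
  obtain ⟨N, hN, hxN⟩ := exists_pow_mem_cocycleKernel hV hm hmV χ x
  refine ⟨N * m, Nat.mul_pos hN hm, ?_⟩
  set y := x ^ N with hy
  set B := (Subgroup.zpowers y).topologicalClosure with hB
  have hcomm : ∀ b ∈ B, Commute y b := by
    have hcl : IsClosed {b : G | y * b = b * y} := isClosed_eq (by fun_prop) (by fun_prop)
    refine fun b hb => closure_minimal (s := (Subgroup.zpowers y : Set G)) ?_ hcl hb
    rintro _ ⟨j, rfl⟩
    exact ((Commute.refl y).zpow_right j).eq
  have hfix : ∀ b ∈ B, ∀ a ∈ B, V.ρ a (χ b) = χ b := fun b hb a ha => by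
    refine closure_minimal (s := (Subgroup.zpowers y : Set G)) ?_
      (hV.isClopen_fixing (χ b) (χ b)).isClosed ha
    rintro _ ⟨j, rfl⟩
    exact cocycle_fixed_of_commute χ ((cocycleKernel χ).zpow_mem hxN j)
      ((hcomm b hb).zpow_left j)
  have hBc : IsCompact (B : Set G) := (Subgroup.isClosed_topologicalClosure _).isCompact
  have hpow : IsClosed ((fun b : G => b ^ m) '' (B : Set G)) :=
    (hBc.image (continuous_pow m)).isClosed
  intro g hg
  have hg' : g ∈ (fun b : G => b ^ m) '' (B : Set G) := by
    refine closure_minimal (s := (Subgroup.zpowers (x ^ (N * m)) : Set G)) ?_ hpow hg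
    rintro _ ⟨j, rfl⟩
    refine ⟨y ^ j, Subgroup.le_topologicalClosure _ ⟨j, rfl⟩, ?_⟩
    simp only [hy, pow_mul]
    rw [← zpow_natCast, ← zpow_natCast _ m, ← zpow_mul, ← zpow_mul, mul_comm]
  obtain ⟨b, hb, rfl⟩ := hg'
  rw [mem_cocycleKernel]
  show χ (b ^ m) = 0
  rw [cocycle_map_pow_of_fixed χ (hfix b hb b hb), hmV]

/-- A cocycle vanishing near `1` is continuous. -/
theorem isCont_of_cocycleKernel_mem_nhds [IsTopologicalGroup G] (χ : cocycles₁ V)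
    (h : (cocycleKernel χ : Set G) ∈ nhds 1) : IsCont V (fun g : G => χ g) := by
  let _ : TopologicalSpace V := ⊥
  have : DiscreteTopology V := ⟨rfl⟩
  show Continuous fun g : G => χ g
  refine ((IsLocallyConstant.iff_eventually_eq _).2 fun g => ?_).continuous
  have ht : Filter.Tendsto (fun y : G => g⁻¹ * y) (nhds g) (nhds 1) := by
    simpa using (continuous_const_mul g⁻¹).tendsto g
  filter_upwards [ht h] with y hy
  have h₁ := (mem_cocycles₁_iff χ).1 χ.2 g (g⁻¹ * y)
  have h₂ : χ (g⁻¹ * y) = 0 := hy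
  rwa [mul_inv_cancel_left, h₂, map_zero, zero_add] at h₁

end Cocycle

section Comparison

open CategoryTheory groupCohomology SmoothRep

variable {k G : Type u} [CommRing k] [Group G] [TopologicalSpace G] {V : Rep.{u} k G}

theorem contCochain_zero_eq_top : contCochain V 0 = ⊤ := by
  refine eq_top_iff.2 fun f _ => ?_
  let _ : TopologicalSpace V := ⊥
  exact continuous_of_const (f := f) fun x y => congrArg f (Subsingleton.elim x y)

theorem isCont_of_cocycle_cochain
    (h : ∀ χ : cocycles₁ V, IsCont V (fun g : G => χ g))
    (f : (Fin 1 → G) → V) (hf : (inhomogeneousCochains.d V 1).hom f = 0) :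
    f ∈ contCochain V 1 := by
  let _ : TopologicalSpace V := ⊥
  have hmem : (fun g : G => f (fun _ => g)) ∈ cocycles₁ V := by
    refine (mem_cocycles₁_def _).2 fun a b => ?_
    have := congrFun hf ![a, b]
    simp only [inhomogeneousCochains.d_hom_apply] at this
    rw [Fin.sum_univ_two] at this
    have e : ∀ g : Fin 1 → G, f g = f fun _ => g 0 := fun g => congrArg f (by
      ext i; rw [Subsingleton.elim i 0])
    rw [e, e (Fin.contractNth 0 _ _), e (Fin.contractNth 1 _ _)] at this
    rw [sub_eq_add_neg, add_assoc]
    simpa [Fin.contractNth, -ModuleCat.hom_comp] using this.trans (Pi.zero_apply _)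
  have h' : Continuous fun g : G => f (fun _ => g) := h ⟨_, hmem⟩
  show Continuous f
  have := h'.comp (continuous_apply (0 : Fin 1) (A := fun _ => G))
  convert this using 1
  funext g
  exact congrArg f (funext fun i => by rw [Subsingleton.elim i 0])

/-- If all abstract `1`-cocycles are continuous, the comparison map in degree `1` is an
isomorphism. -/
theorem isIso_comparison_one [IsTopologicalGroup G] (hV : IsSmooth V)
    (h : ∀ χ : cocycles₁ V, IsCont V (fun g : G => χ g)) : IsIso (comparison hV 1) := by
  have hinj : ∀ n, Mono ((contCochainsInclusion hV).f n) := fun n =>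
    (ModuleCat.mono_iff_injective _).2 Subtype.val_injective
  have hiso : IsIso ((contCochainsInclusion hV).f 0) := by
    have : Epi ((contCochainsInclusion hV).f 0) :=
      (ModuleCat.epi_iff_surjective _).2 fun f =>
        ⟨(⟨f, contCochain_zero_eq_top (V := V) ▸ Submodule.mem_top⟩ : contCochain V 0), rfl⟩
    exact isIso_of_mono_of_epi _
  have hmono : Mono (comparison hV 1) := by
    refine (HomologicalComplex.mono_homologyMap_iff_up_to_refinements _ 0 1 2
      (by simp) (by simp)).2 fun A x₂ _ y₁ hy =>
        ⟨A, 𝟙 A, inferInstance, y₁ ≫ inv ((contCochainsInclusion hV).f 0), ?_⟩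
    rw [← cancel_mono ((contCochainsInclusion hV).f 1), Category.id_comp, hy,
      Category.assoc, Category.assoc, ← HomologicalComplex.Hom.comm, IsIso.inv_hom_id_assoc]
  have hepi : Epi (comparison hV 1) := by
    refine (HomologicalComplex.epi_homologyMap_iff_up_to_refinements _ 0 1 2
      (by simp) (by simp)).2 fun A y₂ hy => ?_
    have hmem : ∀ a : A, y₂.hom a ∈ contCochain V 1 := fun a =>
      isCont_of_cocycle_cochain h _ (by
        rw [inhomogeneousCochains.d_def] at hy
        exact LinearMap.congr_fun (congrArg ModuleCat.Hom.hom hy) a)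
    let x₂ : A ⟶ (contCochains hV).X 1 := ModuleCat.ofHom (y₂.hom.codRestrict _ hmem)
    have hx₂ : x₂ ≫ (contCochainsInclusion hV).f 1 = y₂ := rfl
    refine ⟨A, 𝟙 A, inferInstance, x₂, ?_, 0, by simp [hx₂]⟩
    rw [← cancel_mono ((contCochainsInclusion hV).f 2), Category.assoc,
      ← HomologicalComplex.Hom.comm, ← Category.assoc, hx₂, hy, Limits.zero_comp]
  exact isIso_of_mono_of_epi _

end Comparison

section ApproxAdditive

open Filter Topology

/-- A coordinate system `coord` near the identity of a topological group, with values in `ℚ_[p] ^ d`,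
in which multiplication is addition up to a Lipschitz error of constant `p⁻²`. -/
structure ApproxAddCoord (p : ℕ) [Fact p.Prime] (G : Type u) [Group G] [TopologicalSpace G]
    (d : ℕ) where
  /-- the domain of the coordinates -/
  dom : Submonoid G
  /-- the coordinate map -/
  coord : G → Fin d → ℚ_[p]
  dom_mem_nhds : (dom : Set G) ∈ 𝓝 1
  coord_one : coord 1 = 0
  continuousAt_coord : ContinuousAt coord 1
  tendsto_of_coord {g : G} (hg : g ∈ dom) {q : ℕ → G} (hq : ∀ n, q n ∈ dom)
    (h : Tendsto (fun n => coord (q n)) atTop (𝓝 (coord g))) : Tendsto q atTop (𝓝 g)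
  exists_coord_eq : ∃ r : ℝ, 0 < r ∧ ∀ y, ‖y‖ ≤ r → ∃ g ∈ dom, coord g = y
  norm_coord_mul_sub_le {g h g' h' : G} (hg : g ∈ dom) (hh : h ∈ dom) (hg' : g' ∈ dom)
    (hh' : h' ∈ dom) {s : ℝ} (h₁ : ‖coord g - coord g'‖ ≤ s) (h₂ : ‖coord h - coord h'‖ ≤ s) :
    ‖coord (g * h) - coord (g' * h') - (coord g - coord g') - (coord h - coord h')‖ ≤
      (p : ℝ)⁻¹ * ((p : ℝ)⁻¹ * s)

theorem norm_add_le_of_le_of_le {E : Type*} [SeminormedAddCommGroup E] [IsUltrametricDist E]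
    {x y : E} {s : ℝ} (hx : ‖x‖ ≤ s) (hy : ‖y‖ ≤ s) : ‖x + y‖ ≤ s :=
  (IsUltrametricDist.norm_add_le_max x y).trans (max_le hx hy)

theorem norm_le_of_eq_add {E : Type*} [SeminormedAddCommGroup E] [IsUltrametricDist E]
    {x y z : E} {s : ℝ} (hx : ‖x‖ ≤ s) (hy : ‖y‖ ≤ s) (hz : z = x + y) : ‖z‖ ≤ s :=
  hz ▸ norm_add_le_of_le_of_le hx hy

theorem PadicInt.exists_natCast_norm_sub_le {p : ℕ} [Fact p.Prime] (t : ℚ_[p]) (ht : ‖t‖ ≤ 1)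
    {s : ℝ} (hs : 0 < s) : ∃ b : ℕ, ‖t - b‖ ≤ s := by
  obtain ⟨t, rfl⟩ : ∃ t' : ℤ_[p], (t' : ℚ_[p]) = t := ⟨⟨t, ht⟩, rfl⟩
  obtain ⟨b, hb⟩ := PadicInt.denseRange_natCast.exists_dist_lt t hs
  refine ⟨b, ?_⟩
  rw [dist_eq_norm, PadicInt.norm_def] at hb
  simpa using hb.le

namespace ApproxAddCoord

variable {p : ℕ} [Fact p.Prime] {G : Type u} [Group G] [TopologicalSpace G] {d : ℕ}
  (c : ApproxAddCoord p G d)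

theorem inv_mul_le_self {s : ℝ} (hs : 0 ≤ s) : (p : ℝ)⁻¹ * s ≤ s :=
  mul_le_of_le_one_left hs
    (inv_le_one_of_one_le₀ (by exact_mod_cast (Fact.out : p.Prime).one_le))

theorem norm_coord_mul_sub_sub_le {g h : G} (hg : g ∈ c.dom) (hh : h ∈ c.dom) :
    ‖c.coord (g * h) - c.coord g - c.coord h‖ ≤ (p : ℝ)⁻¹ * ((p : ℝ)⁻¹ * ‖c.coord h‖) := by
  have := c.norm_coord_mul_sub_le hg hh hg c.dom.one_mem (s := ‖c.coord h‖) (by simp)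
    (by simp [c.coord_one])
  simpa [c.coord_one] using this

theorem norm_coord_pow_sub_le {g : G} (hg : g ∈ c.dom) (n : ℕ) :
    ‖c.coord (g ^ n) - (n : ℚ_[p]) • c.coord g‖ ≤ (p : ℝ)⁻¹ * ((p : ℝ)⁻¹ * ‖c.coord g‖) := by
  induction n with
  | zero => simp only [pow_zero, c.coord_one, Nat.cast_zero, zero_smul, sub_self, norm_zero]; positivity
  | succ n ih =>
    rw [pow_succ]
    refine norm_le_of_eq_add (c.norm_coord_mul_sub_sub_le (c.dom.pow_mem hg n) hg) ih ?_
    push_cast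
    module

/-- `g ^ n` has coordinates `n • coord g`, up to a relative error of at most `p⁻¹`. -/
theorem norm_coord_pow_sub_le' {g : G} (hg : g ∈ c.dom) (n : ℕ) :
    ‖c.coord (g ^ n) - (n : ℚ_[p]) • c.coord g‖ ≤
      (p : ℝ)⁻¹ * (‖(n : ℚ_[p])‖ * ‖c.coord g‖) := by
  induction n using Nat.strong_induction_on with
  | _ n ih =>
    rcases eq_or_ne n 0 with rfl | hn
    · simp [c.coord_one]
    by_cases hpn : p ∣ n
    · obtain ⟨l, rfl⟩ := hpn
      have hl : l < p * l := by
        have := (Fact.out : p.Prime).one_lt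
        have : 0 < l := Nat.pos_of_ne_zero (by rintro rfl; simp at hn)
        nlinarith
      have h₁ := ih l hl
      have h₀ : ‖c.coord (g ^ l)‖ ≤ ‖(l : ℚ_[p])‖ * ‖c.coord g‖ := by
        have := norm_add_le_of_le_of_le
          (h₁.trans (inv_mul_le_self (by positivity))) (norm_smul (l : ℚ_[p]) (c.coord g)).le
        simpa using this
      have h₂ := c.norm_coord_pow_sub_le (c.dom.pow_mem hg l) p
      have h₂' : ‖c.coord ((g ^ l) ^ p) - (p : ℚ_[p]) • c.coord (g ^ l)‖ ≤
          (p : ℝ)⁻¹ * ((p : ℝ)⁻¹ * (‖(l : ℚ_[p])‖ * ‖c.coord g‖)) :=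
        h₂.trans (by gcongr)
      have h₃ : ‖(p : ℚ_[p]) • (c.coord (g ^ l) - (l : ℚ_[p]) • c.coord g)‖ ≤
          (p : ℝ)⁻¹ * ((p : ℝ)⁻¹ * (‖(l : ℚ_[p])‖ * ‖c.coord g‖)) := by
        rw [norm_smul, Padic.norm_p]
        gcongr
      rw [mul_comm p l, pow_mul, Nat.cast_mul, norm_mul, Padic.norm_p, mul_comm _ (p : ℝ)⁻¹,
        mul_assoc]
      exact norm_le_of_eq_add h₂' h₃ (by module)
    · have hn1 : ‖(n : ℚ_[p])‖ = 1 := by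
        rw [Padic.norm_natCast_eq_one_iff]
        exact ((Fact.out : p.Prime).coprime_iff_not_dvd).2 hpn
      rw [hn1, one_mul]
      exact (c.norm_coord_pow_sub_le hg n).trans (by
        have := inv_mul_le_self (p := p) (norm_nonneg (c.coord g))
        gcongr)

theorem norm_coord_pow_add_sub_le {g : G} (hg : g ∈ c.dom) (n l : ℕ) :
    ‖c.coord (g ^ (n + l)) - c.coord (g ^ n) - (l : ℚ_[p]) • c.coord g‖ ≤
      (p : ℝ)⁻¹ * (‖(l : ℚ_[p])‖ * ‖c.coord g‖) := by
  have h₁ := c.norm_coord_pow_sub_le' hg l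
  have h₀ : ‖c.coord (g ^ l)‖ ≤ ‖(l : ℚ_[p])‖ * ‖c.coord g‖ := by
    have := norm_add_le_of_le_of_le
      (h₁.trans (inv_mul_le_self (by positivity))) (norm_smul (l : ℚ_[p]) (c.coord g)).le
    simpa using this
  have h₂ := c.norm_coord_mul_sub_sub_le (c.dom.pow_mem hg n) (c.dom.pow_mem hg l)
  rw [pow_add]
  refine norm_le_of_eq_add (h₂.trans ?_) h₁ (by module)
  have := (inv_mul_le_self (p := p) (norm_nonneg (c.coord (g ^ l)))).trans h₀
  gcongr

theorem list_prod_pow_mem {ι : Type*} {x : ι → G} (hx : ∀ i, x i ∈ c.dom) (a : ι → ℕ)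
    (l : List ι) : (l.map fun i => x i ^ a i).prod ∈ c.dom :=
  c.dom.list_prod_mem fun y hy => by
    obtain ⟨i, -, rfl⟩ := List.mem_map.1 hy
    exact c.dom.pow_mem (hx i) _

/-- Coordinates of ordered products of powers are additive in the exponents, up to a relative error
of at most `p⁻¹`. -/
theorem norm_coord_list_prod_sub_le {ι : Type*} {x : ι → G} (hx : ∀ i, x i ∈ c.dom)
    (a b : ι → ℕ) {s : ℝ} (hs : 0 ≤ s) (hb : ∀ i, ‖(b i : ℚ_[p])‖ * ‖c.coord (x i)‖ ≤ s)
    (l : List ι) :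
    ‖c.coord (l.map fun i => x i ^ (a i + b i)).prod - c.coord (l.map fun i => x i ^ a i).prod -
      (l.map fun i => (b i : ℚ_[p]) • c.coord (x i)).sum‖ ≤ (p : ℝ)⁻¹ * s := by
  induction l with
  | nil => simpa using by positivity
  | cons i l ih =>
    have hsum : ∀ l : List ι, ‖(l.map fun i => (b i : ℚ_[p]) • c.coord (x i)).sum‖ ≤ s := by
      intro l
      induction l with
      | nil => simpa using hs
      | cons i l ih =>
        simp only [List.map_cons, List.sum_cons]
        exact norm_add_le_of_le_of_le ((norm_smul _ _).le.trans (hb i)) ih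
    have h₁ : ‖c.coord (x i ^ (a i + b i)) - c.coord (x i ^ a i) -
        (b i : ℚ_[p]) • c.coord (x i)‖ ≤ (p : ℝ)⁻¹ * s :=
      (c.norm_coord_pow_add_sub_le (hx i) (a i) (b i)).trans (by have := hb i; gcongr)
    have h₁' : ‖c.coord (x i ^ (a i + b i)) - c.coord (x i ^ a i)‖ ≤ s := by
      have := norm_add_le_of_le_of_le (h₁.trans (inv_mul_le_self hs))
        ((norm_smul _ _).le.trans (hb i))
      simpa using this
    have h₂' : ‖c.coord (l.map fun i => x i ^ (a i + b i)).prod -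
        c.coord (l.map fun i => x i ^ a i).prod‖ ≤ s := by
      have := norm_add_le_of_le_of_le (ih.trans (inv_mul_le_self hs)) (hsum l)
      simpa using this
    have h₃ := c.norm_coord_mul_sub_le (c.dom.pow_mem (hx i) (a i + b i))
      (c.list_prod_pow_mem hx (fun i => a i + b i) l) (c.dom.pow_mem (hx i) (a i))
      (c.list_prod_pow_mem hx a l) h₁' h₂'
    have h₃' := h₃.trans (inv_mul_le_self (p := p) (by positivity))
    simp only [List.map_cons, List.prod_cons, List.sum_cons]
    exact norm_le_of_eq_add h₃' (norm_add_le_of_le_of_le h₁ ih) (by abel)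

/-- Elements whose coordinates are the vectors `ϖ • e i` of a rescaled standard basis. -/
theorem exists_coord_eq_single : ∃ (ϖ : ℚ_[p]) (x : Fin d → G), ϖ ≠ 0 ∧
    ∀ i, x i ∈ c.dom ∧ c.coord (x i) = Pi.single i ϖ := by
  obtain ⟨r, hr, h⟩ := c.exists_coord_eq
  obtain ⟨ϖ, h0, hϖ⟩ := NormedField.exists_norm_lt ℚ_[p] hr
  choose x hx using fun i : Fin d => h (Pi.single i ϖ) (by rw [Pi.norm_single]; exact hϖ.le)
  exact ⟨ϖ, x, norm_pos_iff.1 h0, hx⟩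

theorem exists_norm_coord_prod_sub_le {ϖ : ℚ_[p]} (hϖ : ϖ ≠ 0) {x : Fin d → G}
    (hx : ∀ i, x i ∈ c.dom) (hxϖ : ∀ i, c.coord (x i) = Pi.single i ϖ) {M : ℕ} (hM : 0 < M)
    {y : Fin d → ℚ_[p]} (hy : ‖y‖ ≤ ‖(M : ℚ_[p]) * ϖ‖) (n : ℕ) :
    ∃ a : Fin d → ℕ,
      ‖y - c.coord ((List.finRange d).map fun i => x i ^ (M * a i)).prod‖ ≤
        (p : ℝ)⁻¹ ^ n * ‖(M : ℚ_[p]) * ϖ‖ := by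
  have hM0 : (M : ℚ_[p]) ≠ 0 := by exact_mod_cast hM.ne'
  have hMϖ : (M : ℚ_[p]) * ϖ ≠ 0 := mul_ne_zero hM0 hϖ
  have hp0 : (0 : ℝ) < (p : ℝ)⁻¹ := by
    have := (Fact.out : p.Prime).pos
    positivity
  have hp1 : (p : ℝ)⁻¹ ≤ 1 :=
    inv_le_one_of_one_le₀ (by exact_mod_cast (Fact.out : p.Prime).one_le)
  induction n with
  | zero =>
    refine ⟨0, ?_⟩
    have : ((List.finRange d).map fun i => x i ^ (M * (0 : Fin d → ℕ) i)).prod = 1 := by simp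
    rw [this, c.coord_one]
    simpa using hy
  | succ n ih =>
    obtain ⟨a, ha⟩ := ih
    set z := y - c.coord ((List.finRange d).map fun i => x i ^ (M * a i)).prod with hz
    have ht : ∀ i, ‖z i / ((M : ℚ_[p]) * ϖ)‖ ≤ (p : ℝ)⁻¹ ^ n := fun i => by
      rw [norm_div, div_le_iff₀ (norm_pos_iff.2 hMϖ)]
      exact (norm_le_pi_norm z i).trans ha
    choose b hb using fun i => PadicInt.exists_natCast_norm_sub_le (z i / ((M : ℚ_[p]) * ϖ))
      ((ht i).trans (pow_le_one₀ hp0.le hp1)) (pow_pos hp0 (n + 1))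
    have hbn : ∀ i, ‖(b i : ℚ_[p])‖ ≤ (p : ℝ)⁻¹ ^ n := fun i => by
      have h := norm_add_le_of_le_of_le (x := -(z i / ((M : ℚ_[p]) * ϖ) - b i))
        (by rw [norm_neg]; exact (hb i).trans (pow_le_pow_of_le_one hp0.le hp1 n.le_succ)) (ht i)
      simpa using h
    refine ⟨a + b, ?_⟩
    have key := c.norm_coord_list_prod_sub_le hx (fun i => M * a i) (fun i => M * b i)
      (s := (p : ℝ)⁻¹ ^ n * ‖(M : ℚ_[p]) * ϖ‖) (by positivity) (fun i => by
        rw [hxϖ, Pi.norm_single, Nat.cast_mul, norm_mul, norm_mul]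
        have := hbn i
        calc ‖(M : ℚ_[p])‖ * ‖(b i : ℚ_[p])‖ * ‖ϖ‖
            = ‖(b i : ℚ_[p])‖ * (‖(M : ℚ_[p])‖ * ‖ϖ‖) := by ring
          _ ≤ _ := by gcongr) (List.finRange d)
    set w := ((List.finRange d).map fun i => ((M * b i : ℕ) : ℚ_[p]) • c.coord (x i)).sum with hw
    have hwi : w = fun i => (M : ℚ_[p]) * ϖ * b i := by
      rw [hw, ← List.sum_ofFn.symm.trans (congrArg List.sum (List.ofFn_eq_map))]
      funext i
      simp only [hxϖ, Finset.sum_apply, Pi.smul_apply, smul_eq_mul, Pi.single_apply]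
      simp
      ring
    have hzw : ‖z - w‖ ≤ (p : ℝ)⁻¹ ^ (n + 1) * ‖(M : ℚ_[p]) * ϖ‖ := by
      refine (pi_norm_le_iff_of_nonneg (by positivity)).2 fun i => ?_
      have : (z - w) i = (z i / ((M : ℚ_[p]) * ϖ) - b i) * ((M : ℚ_[p]) * ϖ) := by
        rw [hwi, Pi.sub_apply]
        field_simp
      rw [this, norm_mul]
      have := hb i
      gcongr
    rw [← norm_neg] at key
    refine norm_le_of_eq_add hzw
      (key.trans_eq (by ring : _ = (p : ℝ)⁻¹ ^ (n + 1) * ‖(M : ℚ_[p]) * ϖ‖)) ?_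
    simp only [Pi.add_apply, mul_add, hz]
    abel

open scoped Pointwise in
/-- For suitable elements `x i`, the ordered products of the procyclic groups generated by the `M`-th
powers of the `x i` form a neighbourhood of `1`, for every `M > 0`. -/
theorem exists_forall_subgroup_mem_nhds [IsTopologicalGroup G] [CompactSpace G] [T2Space G]
    (c : ApproxAddCoord p G d) :
    ∃ x : Fin d → G, ∀ M : ℕ, 0 < M → ∀ K : Subgroup G,
      (∀ i, (Subgroup.zpowers (x i ^ M)).topologicalClosure ≤ K) → (K : Set G) ∈ 𝓝 1 := by
  obtain ⟨ϖ, x, hϖ, hx⟩ := c.exists_coord_eq_single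
  refine ⟨x, fun M hM K hK => ?_⟩
  have hM0 : (M : ℚ_[p]) ≠ 0 := by exact_mod_cast hM.ne'
  have hMϖ : 0 < ‖(M : ℚ_[p]) * ϖ‖ := norm_pos_iff.2 (mul_ne_zero hM0 hϖ)
  let C : Fin d → Set G := fun i => (Subgroup.zpowers (x i ^ M)).topologicalClosure
  have hcompact : ∀ l : List (Fin d), IsCompact (l.map C).prod := fun l => by
    induction l with
    | nil => exact isCompact_singleton
    | cons i l ih =>
      rw [List.map_cons, List.prod_cons]
      exact ((Subgroup.isClosed_topologicalClosure _).isCompact).mul ih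
  have hCK : ∀ l : List (Fin d), (l.map C).prod ⊆ (K : Set G) := fun l => by
    induction l with
    | nil => simp
    | cons i l ih =>
      rw [List.map_cons, List.prod_cons]
      rintro _ ⟨a, ha, b, hb, rfl⟩
      exact K.mul_mem (hK i ha) (ih hb)
  have hmem : ∀ (a : Fin d → ℕ) (l : List (Fin d)),
      (l.map fun i => x i ^ (M * a i)).prod ∈ (l.map C).prod := fun a l => by
    induction l with
    | nil => simp
    | cons i l ih =>
      rw [List.map_cons, List.prod_cons, List.map_cons, List.prod_cons]
      refine Set.mul_mem_mul (Subgroup.le_topologicalClosure _ ?_) ih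
      rw [pow_mul]
      exact Subgroup.pow_mem _ (Subgroup.mem_zpowers _) _
  have hball : ∀ᶠ g in 𝓝 (1 : G), ‖c.coord g‖ ≤ ‖(M : ℚ_[p]) * ϖ‖ := by
    have h := c.continuousAt_coord.norm
    rw [ContinuousAt, c.coord_one, norm_zero] at h
    exact h.eventually (Iic_mem_nhds hMϖ)
  filter_upwards [hball, c.dom_mem_nhds] with g hg hgd
  refine hCK (List.finRange d) ?_
  choose a ha using c.exists_norm_coord_prod_sub_le hϖ (fun i => (hx i).1) (fun i => (hx i).2) hM hg
  have hlim : Tendsto (fun n => ((List.finRange d).map fun i => x i ^ (M * a n i)).prod) atTop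
      (𝓝 g) := by
    refine c.tendsto_of_coord hgd (fun n => c.list_prod_pow_mem (fun i => (hx i).1) _ _) ?_
    refine tendsto_iff_norm_sub_tendsto_zero.2 (squeeze_zero (fun _ => norm_nonneg _)
      (fun n => (norm_sub_rev _ _).trans_le (ha n)) ?_)
    have hp1 : (p : ℝ)⁻¹ < 1 :=
      inv_lt_one_of_one_lt₀ (by exact_mod_cast (Fact.out : p.Prime).one_lt)
    simpa using (tendsto_pow_atTop_nhds_zero_of_lt_one (by positivity) hp1).mul_const
      ‖(M : ℚ_[p]) * ϖ‖
  exact (hcompact _).isClosed.mem_of_tendsto hlim (.of_forall fun n => hmem _ _)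

end ApproxAddCoord

end ApproxAdditive

section Chart

open Filter Topology

variable {p : ℕ} [Fact p.Prime] {G : Type u} [Group G] [TopologicalSpace G] {d : ℕ}

theorem t2Space_of_chartedSpace {H : Type*} [TopologicalSpace H] [T1Space H] [IsTopologicalGroup G]
    [ChartedSpace H G] : T2Space G := by
  refine IsTopologicalGroup.t2Space_of_one_sep fun x hx => ?_
  let e := chartAt H (1 : G)
  by_cases hxe : x ∈ e.source
  · have hne : e 1 ≠ e x := fun h => hx (e.injOn (mem_chart_source H 1) hxe h).symm
    exact ⟨e ⁻¹' {e x}ᶜ, (e.continuousAt (mem_chart_source H 1)).preimage_mem_nhds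
      (isOpen_compl_singleton.mem_nhds hne), fun h => h rfl⟩
  · exact ⟨e.source, chart_source_mem_nhds H 1, hxe⟩

/-- In the chart at `1`, the derivative of the multiplication of a Lie group is addition. -/
theorem hasStrictFDerivAt_mul_chart [ChartedSpace (Fin d → ℚ_[p]) G]
    [LieGroup 𝓘(ℚ_[p], Fin d → ℚ_[p]) ω G] :
    HasStrictFDerivAt (fun z : (Fin d → ℚ_[p]) × (Fin d → ℚ_[p]) =>
      chartAt (Fin d → ℚ_[p]) (1 : G) ((chartAt (Fin d → ℚ_[p]) (1 : G)).symm z.1 *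
        (chartAt (Fin d → ℚ_[p]) (1 : G)).symm z.2))
      (ContinuousLinearMap.fst ℚ_[p] _ _ + ContinuousLinearMap.snd ℚ_[p] _ _)
      (chartAt (Fin d → ℚ_[p]) (1 : G) 1, chartAt (Fin d → ℚ_[p]) (1 : G) 1) := by
  set e := chartAt (Fin d → ℚ_[p]) (1 : G) with he
  set F := fun z : (Fin d → ℚ_[p]) × (Fin d → ℚ_[p]) => e (e.symm z.1 * e.symm z.2) with hF
  have h1 : (1 : G) ∈ e.source := mem_chart_source _ 1
  have hcont : ContDiffAt ℚ_[p] ω F (e 1, e 1) := by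
    have h := (contMDiffAt_iff.1 (ContMDiffMul.contMDiff_mul (I := 𝓘(ℚ_[p], Fin d → ℚ_[p]))
      (n := ω) (G := G) ((1 : G), (1 : G)))).2
    rw [ModelWithCorners.range_eq_univ, contDiffWithinAt_univ] at h
    simp only [mul_one] at h
    exact h
  have hstrict := hcont.analyticAt.hasStrictFDerivAt
  set L := fderiv ℚ_[p] F (e 1, e 1) with hL
  have htarget : e.target ∈ 𝓝 (e 1) := e.open_target.mem_nhds (e.map_source h1)
  have hsymm1 : e.symm (e 1) = 1 := e.left_inv h1
  have hl : L.comp (ContinuousLinearMap.inl ℚ_[p] _ _) = ContinuousLinearMap.id ℚ_[p] _ := by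
    have h₁ : HasFDerivAt (fun x => F (x, e 1))
        (L.comp (ContinuousLinearMap.inl ℚ_[p] _ _)) (e 1) :=
      HasFDerivAt.comp (g := F) (f := fun x => (x, e 1)) (e 1) hstrict.hasFDerivAt
        (hasFDerivAt_prodMk_left (e 1) (e 1))
    refine h₁.unique ((hasFDerivAt_id (e 1)).congr_of_eventuallyEq ?_)
    filter_upwards [htarget] with x hx
    simp [hF, hsymm1, e.right_inv hx]
  have hr : L.comp (ContinuousLinearMap.inr ℚ_[p] _ _) = ContinuousLinearMap.id ℚ_[p] _ := by
    have h₁ : HasFDerivAt (fun x => F (e 1, x))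
        (L.comp (ContinuousLinearMap.inr ℚ_[p] _ _)) (e 1) :=
      HasFDerivAt.comp (g := F) (f := fun x => (e 1, x)) (e 1) hstrict.hasFDerivAt
        (hasFDerivAt_prodMk_right (e 1) (e 1))
    refine h₁.unique ((hasFDerivAt_id (e 1)).congr_of_eventuallyEq ?_)
    filter_upwards [htarget] with x hx
    simp [hF, hsymm1, e.right_inv hx]
  have hLeq : L = ContinuousLinearMap.fst ℚ_[p] _ _ + ContinuousLinearMap.snd ℚ_[p] _ _ := by
    refine ContinuousLinearMap.ext fun z => ?_
    have h₁ := DFunLike.congr_fun hl z.1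
    have h₂ := DFunLike.congr_fun hr z.2
    have : z = (z.1, 0) + (0, z.2) := by simp
    rw [this, map_add]
    simpa using congrArg₂ (· + ·) h₁ h₂
  rwa [hLeq] at hstrict

theorem nonempty_approxAddCoord [IsTopologicalGroup G] [ChartedSpace (Fin d → ℚ_[p]) G]
    [LieGroup 𝓘(ℚ_[p], Fin d → ℚ_[p]) ω G] : Nonempty (ApproxAddCoord p G d) := by
  have hstrict := hasStrictFDerivAt_mul_chart (p := p) (G := G) (d := d)
  set e := chartAt (Fin d → ℚ_[p]) (1 : G) with he
  have h1 : (1 : G) ∈ e.source := mem_chart_source _ 1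
  have hsymm1 : e.symm (e 1) = 1 := e.left_inv h1
  have htarget : e.target ∈ 𝓝 (e 1) := e.open_target.mem_nhds (e.map_source h1)
  have hp0 : (0 : ℝ) < (p : ℝ)⁻¹ := by
    have := (Fact.out : p.Prime).pos
    positivity
  have hev := hstrict.isLittleO.def (mul_pos hp0 hp0)
  have hcs : ContinuousAt e.symm (e 1) := e.continuousAt_symm (e.map_source h1)
  have hmul : ∀ᶠ z : (Fin d → ℚ_[p]) × (Fin d → ℚ_[p]) in 𝓝 (e 1, e 1),
      e.symm z.1 * e.symm z.2 ∈ e.source := by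
    have h : ContinuousAt (fun z : (Fin d → ℚ_[p]) × (Fin d → ℚ_[p]) =>
        e.symm z.1 * e.symm z.2) (e 1, e 1) :=
      (ContinuousAt.comp (x := (e 1, e 1)) (g := e.symm) hcs continuousAt_fst).mul
        (ContinuousAt.comp (x := (e 1, e 1)) (g := e.symm) hcs continuousAt_snd)
    refine h.preimage_mem_nhds ?_
    simp only [hsymm1, mul_one]
    exact chart_source_mem_nhds _ 1
  obtain ⟨r₁, hr₁, hb₁⟩ := Metric.nhds_basis_closedBall.eventually_iff.1 hev
  obtain ⟨r₂, hr₂, hb₂⟩ := Metric.nhds_basis_closedBall.eventually_iff.1 hmul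
  obtain ⟨r₃, hr₃, hb₃⟩ := Metric.nhds_basis_closedBall.mem_iff.1 htarget
  obtain ⟨r, hr, hrr₁, hrr₂, hrr₃⟩ : ∃ r, 0 < r ∧ r ≤ r₁ ∧ r ≤ r₂ ∧ r ≤ r₃ :=
    ⟨min r₁ (min r₂ r₃), by positivity, min_le_left _ _,
      (min_le_right _ _).trans (min_le_left _ _), (min_le_right _ _).trans (min_le_right _ _)⟩
  have hest : ∀ g ∈ e.source, ∀ h ∈ e.source, ∀ g' ∈ e.source, ∀ h' ∈ e.source,
      ‖e g - e 1‖ ≤ r → ‖e h - e 1‖ ≤ r → ‖e g' - e 1‖ ≤ r → ‖e h' - e 1‖ ≤ r →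
      ‖e (g * h) - e (g' * h') - (e g - e g') - (e h - e h')‖ ≤
        (p : ℝ)⁻¹ * (p : ℝ)⁻¹ * max ‖e g - e g'‖ ‖e h - e h'‖ := by
    intro g hg h hh g' hg' h' hh' ng nh ng' nh'
    have := hb₁ (x := ((e g, e h), (e g', e h'))) (by
      simp only [Metric.mem_closedBall, dist_eq_norm, Prod.norm_def, Prod.fst_sub, Prod.snd_sub]
      refine max_le (max_le ?_ ?_) (max_le ?_ ?_) <;> linarith)
    simp only [e.left_inv hg, e.left_inv hh, e.left_inv hg', e.left_inv hh'] at this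
    rw [sub_sub _ (e g - e g')]
    simpa [Prod.norm_def] using this
  have hmem : ∀ g ∈ e.source, ∀ h ∈ e.source, ‖e g - e 1‖ ≤ r → ‖e h - e 1‖ ≤ r →
      g * h ∈ e.source := by
    intro g hg h hh ng nh
    have := hb₂ (x := (e g, e h)) (by
      simp only [Metric.mem_closedBall, dist_eq_norm, Prod.norm_def, Prod.fst_sub, Prod.snd_sub]
      exact max_le (ng.trans hrr₂) (nh.trans hrr₂))
    simpa only [e.left_inv hg, e.left_inv hh] using this
  refine ⟨{
    dom :=
      { carrier := {g | g ∈ e.source ∧ ‖e g - e 1‖ ≤ r}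
        one_mem' := ⟨h1, by simpa using hr.le⟩
        mul_mem' := ?_ }
    coord := fun g => e g - e 1
    dom_mem_nhds := ?_
    coord_one := sub_self _
    continuousAt_coord := (e.continuousAt h1).sub continuousAt_const
    tendsto_of_coord := ?_
    exists_coord_eq := ⟨r, hr, fun y hy => ?_⟩
    norm_coord_mul_sub_le := ?_ }⟩
  · rintro g h ⟨hg, ng⟩ ⟨hh, nh⟩
    refine ⟨hmem g hg h hh ng nh, ?_⟩
    have h₀ := hest g hg h hh 1 h1 1 h1 ng nh (by simpa using hr.le) (by simpa using hr.le)
    rw [mul_assoc] at h₀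
    have h₁ : ‖e (g * h) - e (1 * 1) - (e g - e 1) - (e h - e 1)‖ ≤ r :=
      h₀.trans ((ApproxAddCoord.inv_mul_le_self (by positivity)).trans
        ((ApproxAddCoord.inv_mul_le_self (by positivity)).trans (max_le ng nh)))
    refine norm_le_of_eq_add h₁ (norm_add_le_of_le_of_le ng nh) ?_
    rw [mul_one]
    abel
  · filter_upwards [chart_source_mem_nhds (Fin d → ℚ_[p]) (1 : G),
      (e.continuousAt h1).preimage_mem_nhds (Metric.closedBall_mem_nhds _ hr)] with g hg hg'
    exact ⟨hg, by simpa [dist_eq_norm] using hg'⟩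
  · rintro g ⟨hg, -⟩ q hq hlim
    have h₁ : Tendsto (fun n => e (q n)) atTop (𝓝 (e g)) := by
      simpa using hlim.add_const (e 1)
    have h₂ := (e.continuousAt_symm (e.map_source hg)).tendsto.comp h₁
    rw [e.left_inv hg] at h₂
    refine h₂.congr fun n => ?_
    exact e.left_inv (hq n).1
  · have hy' : e 1 + y ∈ e.target := hb₃ (by simpa [dist_eq_norm] using hy.trans hrr₃)
    refine ⟨e.symm (e 1 + y), ⟨e.map_target hy', ?_⟩, ?_⟩
    · simpa [e.right_inv hy'] using hy
    · simp [e.right_inv hy']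
  · rintro g h g' h' ⟨hg, ng⟩ ⟨hh, nh⟩ ⟨hg', ng'⟩ ⟨hh', nh'⟩ s h₁ h₂
    simp only [sub_sub_sub_cancel_right] at h₁ h₂ ⊢
    refine (hest g hg h hh g' hg' h' hh' ng nh ng' nh').trans ?_
    rw [mul_assoc]
    have := max_le h₁ h₂
    gcongr

end Chart

/-- A `1`-cocycle of a compact `p`-adic analytic group with values in a smooth representation of
finite exponent is continuous. -/
theorem IsPAdicAnalyticGroup.isCont_cocycle {p : ℕ} [Fact p.Prime] {k G : Type u} [CommRing k]
    [Group G] [TopologicalSpace G] [IsTopologicalGroup G] [CompactSpace G]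
    (hG : IsPAdicAnalyticGroup p G) {V : Rep.{u} k G} (hV : SmoothRep.IsSmooth V) {m : ℕ}
    (hm : 0 < m) (hmV : ∀ v : V, m • v = 0) (χ : groupCohomology.cocycles₁ V) :
    SmoothRep.IsCont V (fun g : G => χ g) := by
  obtain ⟨d, _, _⟩ := hG
  have : T2Space G := t2Space_of_chartedSpace (H := Fin d → ℚ_[p])
  obtain ⟨c⟩ := nonempty_approxAddCoord (p := p) (G := G) (d := d)
  obtain ⟨x, hx⟩ := c.exists_forall_subgroup_mem_nhds
  choose M hM hMχ using fun i => exists_closure_zpowers_le_cocycleKernel hV hm hmV χ (x i)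
  refine isCont_of_cocycleKernel_mem_nhds χ
    (hx (∏ i, M i) (Finset.prod_pos fun i _ => hM i) _ fun i => ?_)
  refine (Subgroup.topologicalClosure_mono ?_).trans (hMχ i)
  obtain ⟨l, hl⟩ := Finset.dvd_prod_of_mem M (Finset.mem_univ i)
  rw [Subgroup.zpowers_le, hl, pow_mul]
  exact Subgroup.pow_mem _ (Subgroup.mem_zpowers _) l

theorem theorem1p2 (p : ℕ) [Fact p.Prime]
    (G : Type u) [Group G] [TopologicalSpace G] [IsTopologicalGroup G] [CompactSpace G]
    (hG : IsPAdicAnalyticGroup p G)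
    (k : Type u) [CommRing k] (m : ℕ) [CharP k m] (hm : 0 < m)
    (V : Rep.{u} k G) (hV : SmoothRep.IsSmooth V) :
    (∀ χ : groupCohomology.cocycles₁ V, SmoothRep.IsCont V (fun g : G => χ g)) ∧
      CategoryTheory.IsIso (SmoothRep.comparison hV 1) := by
  have hmV : ∀ v : V, m • v = 0 := fun v => by
    rw [← Nat.cast_smul_eq_nsmul k, CharP.cast_eq_zero, zero_smul]
  have h : ∀ χ : groupCohomology.cocycles₁ V, SmoothRep.IsCont V (fun g : G => χ g) :=
    hG.isCont_cocycle hV hm hmV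
  exact ⟨h, isIso_comparison_one hV h⟩
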